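/- For an integrable weight $w:\mathbb R\to\mathbb R$ with enough finite moments and $n\ge 1$, the correlation function of $w$ is $$\nu_n(w;t)=\int_{T^n(t)}\ \prod_{1\le i<j\le n}(s_i-s_j)^2\; w(s_1)\cdots w(s_n)\,d\mathbf s ,\qquad T^n(t)=\{\mathbf s\in\mathbb R^n:\ s_1+\cdots+s_n=t\},$$ where $d\mathbf s=ds_1\cdots ds_{n-1}$ is Lebesgue measure in the coordinates $(s_1,\dots,s_{n-1})\in\mathbb R^{n-1}$, with $s_n=t-s_1-\cdots-s_{n-1}$ (so $\nu_1(w;t)=w(t)$). **Proposition.** Let $w(t)=e^{-t^2/2}$ and $n\ge 1$. Then for every $t\in\mathbb R$ the integral defining $\nu_n(w;t)$ converges absolutely and $$\nu_n(w;t)=a_n\,e^{-t^2/(2n)},\qquad a_n=\frac{1}{\sqrt n}\,(2\pi)^{(n-1)/2}\prod_{k=1}^{n}k!\,.$$ Moreover, the linear span of the translates $\{e^{-(t-a)^2/(2n)}: a\in\mathbb R\}$ is dense in $L^1(\mathbb R)$ (real span in real $L^1$, and complex span in complex $L^1$). -/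

import Mathlib

open MeasureTheory

noncomputable section

/-- The hyperplane point `(u₁, …, u_m, t - (u₁ + ⋯ + u_m))`, the point of
`T^{m+1}(t) = {s ∈ ℝ^{m+1} : s₁ + ⋯ + s_{m+1} = t}` with free coordinates `u`. -/
def sumPoint {m : ℕ} (t : ℝ) (u : Fin m → ℝ) : Fin (m + 1) → ℝ :=
  Fin.snoc (α := fun _ => ℝ) u (t - ∑ i, u i)

/-- Lebesgue measure `ds₁ ⋯ ds_{n-1}` on `T^n(t) = {s ∈ ℝ^n : s₁ + ⋯ + s_n = t}`, viewed as a
measure on `ℝ^n` carried by `T^n(t)`, where `s_n = t - s₁ - ⋯ - s_{n-1}`.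
For `n = 1` it is the unit mass at `t`; the value for `n = 0` is irrelevant. -/
def sumMeasure : (n : ℕ) → ℝ → Measure (Fin n → ℝ)
  | 0, _ => 0
  | m + 1, t => Measure.map (sumPoint t) (volume : Measure (Fin m → ℝ))

/-- `∏_{i<j} (s_i - s_j)² · w(s₁) ⋯ w(s_n)`. -/
def correlationIntegrand (w : ℝ → ℝ) (n : ℕ) (s : Fin n → ℝ) : ℝ :=
  (∏ i : Fin n, ∏ j ∈ Finset.Ioi i, (s i - s j) ^ 2) * ∏ i : Fin n, w (s i)

/-- The correlation function `ν_n(w; t)` of the measure `w(t) dt`. For `n = 1` it is `w(t)`. -/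
def correlation (w : ℝ → ℝ) (n : ℕ) (t : ℝ) : ℝ :=
  ∫ s, correlationIntegrand w n s ∂(sumMeasure n t)

/-- The linear span, in `L¹(ℝ; 𝕜)`, of (the classes of) the translates `t ↦ f (t - a)`, `a ∈ ℝ`,
of a real function `f`. -/
def translateSpan (𝕜 : Type*) [RCLike 𝕜] (f : ℝ → ℝ) :
    Submodule 𝕜 (Lp 𝕜 1 (volume : Measure ℝ)) :=
  Submodule.span 𝕜 {g | ∃ a : ℝ, (g : ℝ → 𝕜) =ᵐ[volume] fun t => ((f (t - a) : ℝ) : 𝕜)}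

end

/-! For points summing to zero, adding `t / n` to every coordinate leaves the differences alone and
raises the sum of squares by `t ^ 2 / n`. Hence `ν_n(w; t) = ν_n(w; 0) * exp (-t ^ 2 / (2 * n))`.
Integrating over `t` recovers the integral over all of `ℝ^n` (Mehta's integral), which therefore
fixes the constant. Mehta's integral follows from Andréief's identity once the squared Vandermonde
is written with Hermite polynomials, as their Gram matrix is diagonal.

For density, a translated Gaussian is, up to a scalar, `exp (a * x)` times a centred Gaussian.
Splitting that Gaussian into two equal factors moves the question to `L²`, where a function
orthogonal to all `exp (a * x) * exp (-b * x ^ 2)` has a vanishing two-sided Laplace transform after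
weighting, so it is zero. -/

/-! ### Hermite polynomials and their orthogonality. -/

/-- A polynomial is integrable against the standard Gaussian weight. -/
theorem integrable_eval_mul_gaussian (p : Polynomial ℝ) :
    Integrable fun x : ℝ => p.eval x * Real.exp (-x ^ 2 / 2) := by
  induction p using Polynomial.induction_on' with
  | add p q hp hq =>
    refine (hp.add hq).congr (.of_forall fun x => ?_)
    simp [add_mul]
  | monomial k a =>
    have h := (integrable_rpow_mul_exp_neg_mul_sq (b := 1 / 2) (by norm_num) (s := (k : ℝ))
      (by linarith [k.cast_nonneg (α := ℝ)])).const_mul a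
    refine h.congr (.of_forall fun x => ?_)
    simp only [Polynomial.eval_monomial, Real.rpow_natCast, mul_assoc]
    ring_nf

/-- Integration by parts against the standard Gaussian weight. -/
theorem integral_X_mul_eval_mul_gaussian (p : Polynomial ℝ) :
    ∫ x : ℝ, (Polynomial.X * p).eval x * Real.exp (-x ^ 2 / 2) =
      ∫ x : ℝ, (Polynomial.derivative p).eval x * Real.exp (-x ^ 2 / 2) := by
  have hd : ∀ x : ℝ, HasDerivAt (fun x => p.eval x * Real.exp (-x ^ 2 / 2))
      ((Polynomial.derivative p).eval x * Real.exp (-x ^ 2 / 2) -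
        (Polynomial.X * p).eval x * Real.exp (-x ^ 2 / 2)) x := by
    intro x
    have h1 : HasDerivAt (fun x : ℝ => -x ^ 2 / 2) (-x) x := by
      convert! ((hasDerivAt_pow 2 x).neg.div_const 2) using 1
      simp only [Nat.cast_ofNat]
      ring
    convert! (p.hasDerivAt x).mul h1.exp using 1
    simp only [Polynomial.eval_mul, Polynomial.eval_X]
    ring
  have h := integral_eq_zero_of_hasDerivAt_of_integrable hd
    ((integrable_eval_mul_gaussian _).sub (integrable_eval_mul_gaussian _))
    (integrable_eval_mul_gaussian p)
  rw [integral_sub (integrable_eval_mul_gaussian _) (integrable_eval_mul_gaussian _)] at h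
  linarith

/-- The probabilists' Hermite polynomials over `ℝ`. -/
noncomputable def realHermite (n : ℕ) : Polynomial ℝ :=
  (Polynomial.hermite n).map (Int.castRingHom ℝ)

theorem realHermite_monic (n : ℕ) : (realHermite n).Monic :=
  (Polynomial.hermite_monic n).map _

theorem natDegree_realHermite (n : ℕ) : (realHermite n).natDegree = n := by
  rw [realHermite, (Polynomial.hermite_monic n).natDegree_map, Polynomial.natDegree_hermite]

theorem realHermite_succ (n : ℕ) : realHermite (n + 1) =
    Polynomial.X * realHermite n - Polynomial.derivative (realHermite n) := by
  simp [realHermite, Polynomial.hermite_succ, Polynomial.derivative_map]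

/-- Integration by parts turns `X * (H_n * q) - H_n' * q` into `H_n * q'`, so each step down in the
Hermite index costs one derivative of `q`. -/
theorem integral_realHermite_mul (n : ℕ) (q : Polynomial ℝ) :
    ∫ x : ℝ, (realHermite n * q).eval x * Real.exp (-x ^ 2 / 2) =
      ∫ x : ℝ, (Polynomial.derivative^[n] q).eval x * Real.exp (-x ^ 2 / 2) := by
  induction n generalizing q with
  | zero => simp [realHermite]
  | succ n ih =>
    rw [Function.iterate_succ_apply, ← ih]
    have h := integral_X_mul_eval_mul_gaussian (realHermite n * q)
    rw [Polynomial.derivative_mul] at h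
    simp only [Polynomial.eval_add, add_mul] at h
    rw [integral_add (integrable_eval_mul_gaussian _) (integrable_eval_mul_gaussian _)] at h
    have e : realHermite (n + 1) * q = Polynomial.X * (realHermite n * q) -
        Polynomial.derivative (realHermite n) * q := by
      rw [realHermite_succ]; ring
    rw [e]
    simp only [Polynomial.eval_sub, sub_mul]
    rw [integral_sub (integrable_eval_mul_gaussian _) (integrable_eval_mul_gaussian _), h]
    ring

theorem integral_exp_neg_sq_div_two_mul {a : ℝ} (ha : 0 < a) :
    ∫ x : ℝ, Real.exp (-x ^ 2 / (2 * a)) = Real.sqrt (2 * Real.pi * a) := by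
  have h := integral_gaussian (1 / (2 * a))
  rw [show Real.pi / (1 / (2 * a)) = 2 * Real.pi * a by field_simp] at h
  rw [← h]
  congr 1; ext x; congr 1; field_simp

theorem integral_realHermite_mul_realHermite (m n : ℕ) :
    ∫ x : ℝ, (realHermite m).eval x * ((realHermite n).eval x * Real.exp (-x ^ 2 / 2)) =
      if m = n then Real.sqrt (2 * Real.pi) * n.factorial else 0 := by
  wlog hmn : n ≤ m generalizing m n
  · have h := this n m (by omega)
    rw [if_neg (by omega)] at h ⊢
    rw [← h]
    congr 1; ext x; ring
  have h := integral_realHermite_mul m (realHermite n)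
  simp only [Polynomial.eval_mul, mul_assoc] at h
  rw [h]
  -- Differentiating the monic `realHermite n` of degree `n` leaves `n!` after `n` steps and `0`
  -- after more.
  rcases hmn.eq_or_lt with rfl | hlt
  · have hc : Polynomial.derivative^[n] (realHermite n) = Polynomial.C (n.factorial : ℝ) := by
      have hdeg : (Polynomial.derivative^[n] (realHermite n)).natDegree = 0 := by
        have := Polynomial.natDegree_iterate_derivative (realHermite n) n
        rw [natDegree_realHermite] at this
        omega
      have hcoeff : (realHermite n).coeff n = 1 := by
        have := realHermite_monic n
        rwa [Polynomial.Monic, Polynomial.leadingCoeff, natDegree_realHermite] at this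
      rw [Polynomial.eq_C_of_natDegree_eq_zero hdeg, Polynomial.coeff_iterate_derivative]
      simp [hcoeff, Nat.descFactorial_self]
    rw [hc]
    have hg := integral_exp_neg_sq_div_two_mul one_pos
    simp only [mul_one] at hg
    simp only [Polynomial.eval_C, if_true]
    rw [integral_const_mul, hg, mul_comm]
  · rw [if_neg (by omega), Polynomial.iterate_derivative_eq_zero (by rwa [natDegree_realHermite])]
    simp

/-! ### Andréief's identity and Mehta's integral. -/

/-- **Andréief's identity**. -/
theorem integrable_and_integral_det_mul_det {α : Type*} [MeasureSpace α]
    [SigmaFinite (volume : Measure α)] {n : ℕ} (f g : Fin n → α → ℝ)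
    (hfg : ∀ i j, Integrable fun x => f i x * g j x) :
    Integrable (fun x : Fin n → α => (Matrix.of fun i j => f i (x j)).det *
        (Matrix.of fun i j => g i (x j)).det) ∧
      ∫ x : Fin n → α, (Matrix.of fun i j => f i (x j)).det *
        (Matrix.of fun i j => g i (x j)).det =
      n.factorial * (Matrix.of fun i j => ∫ x, f i x * g j x).det := by
  have hexp : ∀ x : Fin n → α, (Matrix.of fun i j => f i (x j)).det *
      (Matrix.of fun i j => g i (x j)).det =
      ∑ τ : Equiv.Perm (Fin n), ∑ σ : Equiv.Perm (Fin n),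
        ((Equiv.Perm.sign σ : ℤ) * (Equiv.Perm.sign τ : ℤ) : ℝ) *
          ∏ i, (f (σ i) (x i) * g (τ i) (x i)) := by
    intro x
    rw [Matrix.det_apply', Matrix.det_apply', Finset.sum_mul_sum, Finset.sum_comm]
    refine Finset.sum_congr rfl fun τ _ => Finset.sum_congr rfl fun σ _ => ?_
    simp only [Matrix.of_apply, Finset.prod_mul_distrib]
    ring
  have hint : ∀ σ τ : Equiv.Perm (Fin n), Integrable fun x : Fin n → α =>
      ((Equiv.Perm.sign σ : ℤ) * (Equiv.Perm.sign τ : ℤ) : ℝ) *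
          ∏ i, (f (σ i) (x i) * g (τ i) (x i)) := fun σ τ =>
    (Integrable.fintype_prod (f := fun i y => f (σ i) y * g (τ i) y)
      fun i => hfg (σ i) (τ i)).const_mul _
  simp only [hexp]
  refine ⟨integrable_finsetSum _ fun τ _ => integrable_finsetSum _ fun σ _ => hint σ τ, ?_⟩
  rw [integral_finsetSum _ fun τ _ => integrable_finsetSum _ fun σ _ => hint σ τ]
  have hτ : ∀ τ : Equiv.Perm (Fin n), (∫ x : Fin n → α, ∑ σ : Equiv.Perm (Fin n),
        ((Equiv.Perm.sign σ : ℤ) * (Equiv.Perm.sign τ : ℤ) : ℝ) *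
          ∏ i, (f (σ i) (x i) * g (τ i) (x i))) =
      (Matrix.of fun i j => ∫ x, f i x * g j x).det := by
    intro τ
    rw [integral_finsetSum _ fun σ _ => hint σ τ, Matrix.det_apply']
    -- Reindexing by `σ * τ⁻¹` shows that every `τ` contributes the same determinant, whence the
    -- factor `n!`.
    refine (Finset.sum_congr rfl fun σ _ => ?_).trans (Equiv.sum_comp (Equiv.mulRight τ⁻¹) _)
    rw [integral_const_mul,
      integral_fintype_prod_volume_eq_prod (fun i y => f (σ i) y * g (τ i) y)]
    rw [← Equiv.prod_comp τ fun i => Matrix.of (fun i j => ∫ x, f i x * g j x)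
      (Equiv.mulRight τ⁻¹ σ i) i]
    simp [Equiv.Perm.sign_mul]
  simp only [hτ, Finset.sum_const, Finset.card_univ, Fintype.card_perm, Fintype.card_fin,
    nsmul_eq_mul]

theorem factorial_mul_prod_factorial (n : ℕ) :
    (n.factorial : ℝ) * ∏ i : Fin n, ((i : ℕ).factorial : ℝ) =
      ∏ k ∈ Finset.Icc 1 n, (k.factorial : ℝ) := by
  rw [Fin.prod_univ_eq_prod_range (fun i => (i.factorial : ℝ)) n]
  induction n with
  | zero => simp
  | succ n ih =>
    rw [Finset.prod_range_succ, Finset.prod_Icc_succ_top (by omega), ← ih]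
    ring

/-- Mehta's integral for the Gaussian unitary ensemble. -/
theorem integrable_and_integral_correlationIntegrand_gaussian (n : ℕ) :
    Integrable (correlationIntegrand (fun x => Real.exp (-x ^ 2 / 2)) n) ∧
      ∫ s, correlationIntegrand (fun x => Real.exp (-x ^ 2 / 2)) n s =
        Real.sqrt (2 * Real.pi) ^ n * ∏ k ∈ Finset.Icc 1 n, (k.factorial : ℝ) := by
  -- Monic polynomials of degrees `0, …, n - 1` have the same determinant as the Vandermonde matrix;
  -- all the weights go into one of its two copies.
  have hF : correlationIntegrand (fun x => Real.exp (-x ^ 2 / 2)) n = fun s =>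
      (Matrix.of fun i j : Fin n => (realHermite i).eval (s j)).det *
      (Matrix.of fun i j : Fin n => (realHermite i).eval (s j) * Real.exp (-s j ^ 2 / 2)).det := by
    ext s
    have h1 : (∏ i : Fin n, ∏ j ∈ Finset.Ioi i, (s i - s j) ^ 2) =
        (Matrix.vandermonde s).det ^ 2 := by
      rw [Matrix.det_vandermonde, ← Finset.prod_pow]
      refine Finset.prod_congr rfl fun i _ => ?_
      rw [← Finset.prod_pow]
      exact Finset.prod_congr rfl fun j _ => by ring
    have h2 := Matrix.det_eval_matrixOfPolynomials_eq_det_vandermonde s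
      (fun i => realHermite i) (fun i => natDegree_realHermite i) (fun i => realHermite_monic i)
    have h3 := Matrix.det_mul_row (fun j => Real.exp (-s j ^ 2 / 2))
      (Matrix.of fun i j : Fin n => (realHermite i).eval (s j))
    rw [← Matrix.det_transpose] at h2
    have h4 : (Matrix.of fun i j : Fin n => (realHermite j).eval (s i)).transpose =
      Matrix.of fun i j : Fin n => (realHermite i).eval (s j) := rfl
    rw [← Matrix.det_transpose (Matrix.of _), h4, Matrix.det_transpose] at h2
    simp only [Matrix.of_apply, mul_comm (Real.exp _)] at h3
    rw [correlationIntegrand, h1, h3, h2]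
    ring
  obtain ⟨hi, hv⟩ := integrable_and_integral_det_mul_det
    (fun (i : Fin n) x => (realHermite i).eval x)
    (fun (i : Fin n) x => (realHermite i).eval x * Real.exp (-x ^ 2 / 2)) (fun i j => by
      have := integrable_eval_mul_gaussian (realHermite i * realHermite j)
      simpa only [Polynomial.eval_mul, mul_assoc] using this)
  rw [hF]
  refine ⟨hi, hv.trans ?_⟩
  have hM : (Matrix.of fun i j : Fin n => ∫ x : ℝ, (realHermite i).eval x *
      ((realHermite j).eval x * Real.exp (-x ^ 2 / 2))) =
      Matrix.diagonal fun i : Fin n => Real.sqrt (2 * Real.pi) * (i : ℕ).factorial := by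
    ext i j
    rw [Matrix.of_apply, integral_realHermite_mul_realHermite, Matrix.diagonal_apply]
    by_cases h : i = j
    · simp [h]
    · rw [if_neg h, if_neg (fun h' => h (Fin.ext h'))]
  rw [hM, Matrix.det_diagonal, Finset.prod_mul_distrib, ← factorial_mul_prod_factorial]
  simp only [Finset.prod_const, Finset.card_univ, Fintype.card_fin]
  ring

/-! ### Slicing `ℝ^n` by the hyperplanes of constant coordinate sum. -/

theorem measurable_sumPoint {m : ℕ} :
    Measurable fun p : ℝ × (Fin m → ℝ) => sumPoint p.1 p.2 := by
  refine measurable_pi_lambda _ fun i => ?_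
  refine Fin.lastCases ?_ (fun j => ?_) i
  · simp only [sumPoint, Fin.snoc_last]
    fun_prop
  · simp only [sumPoint, Fin.snoc_castSucc]
    fun_prop

/-- Up to reordering coordinates the map is a shear: for fixed `u` it translates `t` by `-∑ u i`.
This is what permits Fubini over the slices. -/
theorem measurePreserving_sumPoint (m : ℕ) :
    MeasurePreserving (fun p : ℝ × (Fin m → ℝ) => sumPoint p.1 p.2) := by
  have h1 : MeasurePreserving (fun p : (Fin m → ℝ) × ℝ => (p.1, p.2 - ∑ i, p.1 i))
      (volume.prod volume) (volume.prod volume) :=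
    MeasurePreserving.skew_product (g := fun (u : Fin m → ℝ) (t : ℝ) => t - ∑ i, u i)
      (MeasurePreserving.id _) (by unfold Function.uncurry; fun_prop)
      (.of_forall fun u => map_sub_right_eq_self _ _)
  have h2 := ((volume_preserving_piFinSuccAbove (fun _ : Fin (m + 1) => ℝ) (Fin.last m)).symm _)
  have h3 := h2.comp ((Measure.measurePreserving_swap.comp h1).comp
    (Measure.measurePreserving_swap (μ := (volume : Measure ℝ))
      (ν := (volume : Measure (Fin m → ℝ)))))
  convert! h3 using 1
  ext p i
  simp [sumPoint, MeasurableEquiv.piFinSuccAbove, Fin.insertNthEquiv, Fin.insertNth_last']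

/-- The cross term in the sum of squares vanishes because the coordinates of `sumPoint 0 u` sum to
zero. -/
theorem correlationIntegrand_gaussian_sumPoint_add {m : ℕ} (t : ℝ) (u : Fin m → ℝ) :
    correlationIntegrand (fun x => Real.exp (-x ^ 2 / 2)) (m + 1)
        (sumPoint t (u + fun _ => t / (m + 1 : ℕ))) =
      Real.exp (-t ^ 2 / (2 * (m + 1 : ℕ))) *
        correlationIntegrand (fun x => Real.exp (-x ^ 2 / 2)) (m + 1) (sumPoint 0 u) := by
  have hm : ((m + 1 : ℕ) : ℝ) ≠ 0 := by positivity
  have hs : sumPoint t (u + fun _ => t / (m + 1 : ℕ)) =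
      fun i => sumPoint 0 u i + t / (m + 1 : ℕ) := by
    ext i
    refine Fin.lastCases ?_ (fun j => ?_) i
    · simp only [sumPoint, Fin.snoc_last, Pi.add_apply, Finset.sum_add_distrib, Finset.sum_const,
        Finset.card_univ, Fintype.card_fin, nsmul_eq_mul]
      field_simp
      push_cast
      ring
    · simp [sumPoint]
  have h0 : ∑ i, sumPoint 0 u i = 0 := by
    simp [sumPoint, Fin.sum_univ_castSucc]
  rw [hs]
  generalize sumPoint 0 u = v at h0 ⊢
  simp only [correlationIntegrand, add_sub_add_right_eq_sub, ← Real.exp_sum]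
  rw [mul_left_comm, ← Real.exp_add]
  congr 2
  have : ∀ i, -(v i + t / (m + 1 : ℕ)) ^ 2 / 2 =
      -v i ^ 2 / 2 + (-(t / (m + 1 : ℕ)) * v i + -(t / (m + 1 : ℕ)) ^ 2 / 2) := fun i => by ring
  simp only [this, Finset.sum_add_distrib, ← Finset.mul_sum, h0, Finset.sum_const,
    Finset.card_univ, Fintype.card_fin, nsmul_eq_mul]
  field_simp
  ring

theorem continuous_correlationIntegrand {w : ℝ → ℝ} (hw : Continuous w) (n : ℕ) :
    Continuous (correlationIntegrand w n) := by
  unfold correlationIntegrand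
  fun_prop

theorem integrable_correlationIntegrand_gaussian_sumPoint_iff {m : ℕ} (t : ℝ) :
    Integrable (fun u : Fin m → ℝ =>
      correlationIntegrand (fun x => Real.exp (-x ^ 2 / 2)) (m + 1) (sumPoint t u)) ↔
    Integrable (fun u : Fin m → ℝ =>
      correlationIntegrand (fun x => Real.exp (-x ^ 2 / 2)) (m + 1) (sumPoint 0 u)) := by
  rw [← (measurePreserving_add_right (volume : Measure (Fin m → ℝ))
    (fun _ => t / (m + 1 : ℕ))).integrable_comp_emb
      (MeasurableEquiv.addRight _).measurableEmbedding]
  simp only [Function.comp_def, correlationIntegrand_gaussian_sumPoint_add]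
  exact integrable_const_mul_iff (Real.exp_pos _).ne'.isUnit _

theorem integral_correlationIntegrand_gaussian_sumPoint {m : ℕ} (t : ℝ) :
    ∫ u : Fin m → ℝ,
      correlationIntegrand (fun x => Real.exp (-x ^ 2 / 2)) (m + 1) (sumPoint t u) =
    Real.exp (-t ^ 2 / (2 * (m + 1 : ℕ))) * ∫ u : Fin m → ℝ,
      correlationIntegrand (fun x => Real.exp (-x ^ 2 / 2)) (m + 1) (sumPoint 0 u) := by
  rw [← integral_add_right_eq_self _ (fun _ => t / (m + 1 : ℕ))]
  simp only [correlationIntegrand_gaussian_sumPoint_add, integral_const_mul]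

theorem integrable_and_correlation_gaussian {n : ℕ} (hn : 1 ≤ n) (t : ℝ) :
    Integrable (correlationIntegrand (fun x => Real.exp (-x ^ 2 / 2)) n) (sumMeasure n t) ∧
      correlation (fun x => Real.exp (-x ^ 2 / 2)) n t =
        (1 / Real.sqrt n * (2 * Real.pi) ^ (((n : ℝ) - 1) / 2) *
          ∏ k ∈ Finset.Icc 1 n, (Nat.factorial k : ℝ)) * Real.exp (-t ^ 2 / (2 * n)) := by
  obtain ⟨m, rfl⟩ := Nat.exists_eq_add_of_le' hn
  have hc : Continuous (correlationIntegrand (fun x => Real.exp (-x ^ 2 / 2)) (m + 1)) :=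
    continuous_correlationIntegrand (by fun_prop) _
  have hsp : ∀ t, AEMeasurable (sumPoint (m := m) t) := fun t =>
    (measurable_sumPoint.comp measurable_prodMk_left).aemeasurable
  obtain ⟨hi, hv⟩ := integrable_and_integral_correlationIntegrand_gaussian (m + 1)
  have hi' : Integrable (fun p : ℝ × (Fin m → ℝ) =>
      correlationIntegrand (fun x => Real.exp (-x ^ 2 / 2)) (m + 1) (sumPoint p.1 p.2)) :=
    (measurePreserving_sumPoint m).integrable_comp_of_integrable hi
  have hv' := integral_map (μ := volume) (measurePreserving_sumPoint m).measurable.aemeasurable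
    (f := correlationIntegrand (fun x => Real.exp (-x ^ 2 / 2)) (m + 1))
    hc.aestronglyMeasurable
  rw [(measurePreserving_sumPoint m).map_eq, hv, Measure.volume_eq_prod,
    integral_prod _ hi'] at hv'
  -- The slice at `t` is the slice at `0` times a Gaussian in `t` of total mass `√(2πn)`, so Mehta's
  -- value equals `√(2πn)` times the slice integral at `0`.
  rw [integral_congr_ae (.of_forall fun t => integral_correlationIntegrand_gaussian_sumPoint t),
    integral_mul_const, integral_exp_neg_sq_div_two_mul (by positivity)] at hv'
  have hi0 : Integrable (fun u : Fin m → ℝ =>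
      correlationIntegrand (fun x => Real.exp (-x ^ 2 / 2)) (m + 1) (sumPoint 0 u)) := by
    -- Fubini gives integrability only for almost every slice; one good slice suffices, since all
    -- are translates of each other up to a positive factor.
    obtain ⟨t, ht⟩ := hi'.prod_right_ae.exists
    exact (integrable_correlationIntegrand_gaussian_sumPoint_iff t).1 ht
  refine ⟨?_, ?_⟩
  · rw [sumMeasure, integrable_map_measure hc.aestronglyMeasurable (hsp t)]
    exact (integrable_correlationIntegrand_gaussian_sumPoint_iff t).2 hi0
  · rw [correlation, sumMeasure, integral_map (hsp t) hc.aestronglyMeasurable,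
      integral_correlationIntegrand_gaussian_sumPoint, mul_comm]
    congr 1
    have h2 : 0 < Real.sqrt (2 * Real.pi) := by positivity
    have hN : 0 < Real.sqrt (m + 1 : ℕ) := by positivity
    have hp : (2 * Real.pi) ^ ((((m + 1 : ℕ) : ℝ) - 1) / 2) = Real.sqrt (2 * Real.pi) ^ m := by
      rw [Real.sqrt_eq_rpow, ← Real.rpow_natCast, ← Real.rpow_mul (by positivity)]
      congr 1
      push_cast
      ring
    rw [Real.sqrt_mul (by positivity : (0 : ℝ) ≤ 2 * Real.pi) ((m + 1 : ℕ) : ℝ)] at hv'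
    rw [hp]
    generalize (∫ u : Fin m → ℝ,
      correlationIntegrand (fun x => Real.exp (-x ^ 2 / 2)) (m + 1) (sumPoint 0 u)) = J at hv' ⊢
    have hJ : Real.sqrt (2 * Real.pi) ^ m * ∏ k ∈ Finset.Icc 1 (m + 1), (k.factorial : ℝ) =
        Real.sqrt (m + 1 : ℕ) * J :=
      mul_left_cancel₀ h2.ne' (by linear_combination hv')
    rw [mul_assoc, hJ]
    field_simp

/-! ### Injectivity of the two-sided Laplace transform. -/

open ProbabilityTheory in
-- Applied to `f` and to `-f`, this represents the positive and negative parts of `f` as finite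
-- measures with all exponential moments.
theorem withDensity_ofReal_exp_integrable {f : ℝ → ℝ}
    (hf : ∀ a : ℝ, Integrable fun x => Real.exp (a * x) * f x) :
    (∀ a : ℝ, Integrable (fun x => Real.exp (a * x))
      (volume.withDensity fun x => ENNReal.ofReal (f x))) ∧
    (∀ a : ℝ, mgf id (volume.withDensity fun x => ENNReal.ofReal (f x)) a =
      ∫ x, Real.exp (a * x) * max (f x) 0) ∧
    IsFiniteMeasure (volume.withDensity fun x => ENNReal.ofReal (f x)) := by
  have h0 : Integrable f := by simpa using hf 0
  have hm : AEMeasurable fun x => ENNReal.ofReal (f x) := h0.aemeasurable.ennreal_ofReal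
  refine ⟨fun a => ?_, fun a => ?_, isFiniteMeasure_withDensity_ofReal h0.2⟩
  · rw [integrable_withDensity_iff_integrable_smul₀' hm (.of_forall fun _ => ENNReal.ofReal_lt_top)]
    refine (hf a).mono ?_ (.of_forall fun x => ?_)
    · exact (hm.ennreal_toReal.smul (by fun_prop)).aestronglyMeasurable
    · rw [smul_eq_mul, mul_comm, norm_mul, norm_mul]
      gcongr
      rw [ENNReal.toReal_ofReal', Real.norm_eq_abs, Real.norm_eq_abs,
        abs_of_nonneg (le_max_right _ _)]
      exact max_le (le_abs_self _) (abs_nonneg _)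
  · rw [mgf, integral_withDensity_eq_integral_toReal_smul₀ hm
      (.of_forall fun _ => ENNReal.ofReal_lt_top)]
    simp [ENNReal.toReal_ofReal', mul_comm]

open ProbabilityTheory in
/-- Injectivity of the two-sided Laplace transform, for functions of exponential decay. -/
theorem ae_eq_zero_of_integral_exp_mul_eq_zero {f : ℝ → ℝ}
    (hf : ∀ a : ℝ, Integrable fun x => Real.exp (a * x) * f x)
    (h : ∀ a : ℝ, ∫ x, Real.exp (a * x) * f x = 0) : f =ᵐ[volume] 0 := by
  have h0 : Integrable f := by simpa using hf 0
  have hf' : ∀ a : ℝ, Integrable fun x => Real.exp (a * x) * (-f) x := fun a => by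
    simpa using (hf a).neg
  obtain ⟨ep, mp, _⟩ := withDensity_ofReal_exp_integrable hf
  obtain ⟨en, mn, _⟩ := withDensity_ofReal_exp_integrable hf'
  have hpos : ∀ {g : ℝ → ℝ}, (∀ a : ℝ, Integrable fun x => Real.exp (a * x) * g x) →
      ∀ a : ℝ, Integrable fun x => Real.exp (a * x) * max (g x) 0 := fun {g} hg a => by
    refine (hg a).pos_part.congr (.of_forall fun x => ?_)
    simp [mul_max_of_nonneg _ _ (Real.exp_pos (a * x)).le]
  -- The difference of the two sides at `a` is the Laplace transform of `f` at `a`, which vanishes.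
  have hmgf : mgf id (volume.withDensity fun x => ENNReal.ofReal (f x)) =
      mgf id (volume.withDensity fun x => ENNReal.ofReal ((-f) x)) := by
    ext a
    rw [mp, mn, ← sub_eq_zero, ← integral_sub (hpos hf a) (hpos hf' a)]
    refine Eq.trans ?_ (h a)
    congr 1; ext x
    rw [← mul_sub, Pi.neg_apply]
    congr 1
    rcases le_total 0 (f x) with hx | hx
    · rw [max_eq_left hx, max_eq_right (by linarith), sub_zero]
    · rw [max_eq_right hx, max_eq_left (by linarith)]; ring
  generalize hP : (volume.withDensity fun x => ENNReal.ofReal (f x)) = P at *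
  generalize hN : (volume.withDensity fun x => ENNReal.ofReal ((-f) x)) = N at *
  have hzero : P = 0 ↔ N = 0 := by
    have := congrFun hmgf 0
    simp only [mgf_zero'] at this
    rw [← Measure.measure_univ_eq_zero, ← Measure.measure_univ_eq_zero,
      ← measureReal_eq_zero_iff, ← measureReal_eq_zero_iff, this]
  -- With all exponential moments finite, the strip on which equality of the `mgf` extends to
  -- `complexMGF` is the whole plane.
  have hset : integrableExpSet id P = Set.univ := Set.eq_univ_of_forall ep
  have hc : complexMGF id P = complexMGF id N := by
    ext z
    exact eqOn_complexMGF_of_mgf' hmgf hzero (by simp [hset])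
  have hPN := Measure.ext_of_complexMGF_eq aemeasurable_id aemeasurable_id hc
  rw [Measure.map_id, Measure.map_id, ← hP, ← hN,
    withDensity_eq_iff_of_sigmaFinite h0.aemeasurable.ennreal_ofReal
      h0.neg.aemeasurable.ennreal_ofReal] at hPN
  -- The positive and negative parts of `f` agree almost everywhere, and one of them is always zero.
  filter_upwards [hPN] with x hx
  rcases le_total 0 (f x) with hx0 | hx0
  · rw [ENNReal.ofReal_of_nonpos (p := (-f) x) (by simpa using hx0), ENNReal.ofReal_eq_zero] at hx
    exact le_antisymm hx hx0
  · rw [ENNReal.ofReal_of_nonpos hx0, eq_comm, ENNReal.ofReal_eq_zero] at hx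
    exact le_antisymm hx0 (by simpa using hx)

/-! ### Density of the translates of a Gaussian in `L¹`. -/

theorem integrable_exp_neg_mul_sq_add_mul {b : ℝ} (hb : 0 < b) (a : ℝ) :
    Integrable fun x : ℝ => Real.exp (-b * x ^ 2 + a * x) := by
  refine (((integrable_exp_neg_mul_sq hb).comp_sub_right (a / (2 * b))).const_mul
    (Real.exp (a ^ 2 / (4 * b)))).congr (.of_forall fun x => ?_)
  simp only [← Real.exp_add]
  congr 1
  field_simp
  ring

theorem memLp_two_exp_neg_mul_sq_add_mul {b : ℝ} (hb : 0 < b) (a : ℝ) :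
    MemLp (fun x : ℝ => Real.exp (-b * x ^ 2 + a * x)) 2 := by
  rw [memLp_two_iff_integrable_sq (by fun_prop)]
  refine (integrable_exp_neg_mul_sq_add_mul (b := 2 * b) (by positivity) (2 * a)).congr
    (.of_forall fun x => ?_)
  simp only [← Real.exp_nat_mul]
  congr 1
  push_cast
  ring

/-- If `h` is orthogonal to the span, then `exp (-b * x ^ 2) * h x` has zero Laplace transform;
working in `L²` makes the orthogonal complement available. -/
theorem span_exp_mul_gaussian_dense {b : ℝ} (hb : 0 < b) :
    Dense (Submodule.span ℝ (Set.range fun a : ℝ =>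
      (memLp_two_exp_neg_mul_sq_add_mul hb a).toLp) : Set (Lp ℝ 2 (volume : Measure ℝ))) := by
  rw [Submodule.dense_iff_topologicalClosure_eq_top, Submodule.topologicalClosure_eq_top_iff,
    Submodule.eq_bot_iff]
  intro h hh
  have hint : ∀ a : ℝ, Integrable fun x => Real.exp (a * x) * (Real.exp (-b * x ^ 2) * h x) := by
    intro a
    have := (memLp_two_exp_neg_mul_sq_add_mul hb a).integrable_mul (Lp.memLp h)
    refine this.congr (.of_forall fun x => ?_)
    simp only [Pi.mul_apply, ← mul_assoc, ← Real.exp_add, add_comm]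
  have hz : ∀ a : ℝ, ∫ x, Real.exp (a * x) * (Real.exp (-b * x ^ 2) * h x) = 0 := by
    intro a
    rw [← (Submodule.mem_orthogonal _ _).1 hh _ (Submodule.subset_span ⟨a, rfl⟩), L2.inner_def]
    refine integral_congr_ae ?_
    filter_upwards [(memLp_two_exp_neg_mul_sq_add_mul hb a).coeFn_toLp] with x hx
    rw [hx, ← mul_assoc, ← Real.exp_add]
    simp [mul_comm, add_comm]
  refine Lp.ext ?_
  filter_upwards [ae_eq_zero_of_integral_exp_mul_eq_zero hint hz,
    Lp.coeFn_zero ℝ 2 (volume : Measure ℝ)] with x hx h0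
  rw [h0]
  simpa using hx

theorem memLp_translate_gaussian {c : ℝ} (hc : 0 < c) (a : ℝ) :
    MemLp (fun t : ℝ => Real.exp (-(t - a) ^ 2 / (2 * c))) 1 := by
  rw [memLp_one_iff_integrable]
  refine ((integrable_exp_neg_mul_sq_add_mul (b := 1 / (2 * c)) (by positivity)
    (a / c)).const_mul (Real.exp (-a ^ 2 / (2 * c)))).congr (.of_forall fun t => ?_)
  simp only [← Real.exp_add]
  congr 1
  field_simp
  ring

theorem dense_translateSpan_gaussian_real {c : ℝ} (hc : 0 < c) :
    Dense (translateSpan ℝ (fun t => Real.exp (-t ^ 2 / (2 * c))) :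
      Set (Lp ℝ 1 (volume : Measure ℝ))) := by
  have hb : 0 < 1 / (4 * c) := by positivity
  have e : ∀ a : ℝ, MemLp (fun x : ℝ => Real.exp (-(1 / (4 * c)) * x ^ 2 + a * x)) 2 :=
    fun a => memLp_two_exp_neg_mul_sq_add_mul hb a
  -- Multiplication by the square root of the target Gaussian, hence the rate `1 / (4 * c)`; Hölder
  -- makes it continuous from `L²` to `L¹`.
  let M : Lp ℝ 2 (volume : Measure ℝ) →L[ℝ] Lp ℝ 1 (volume : Measure ℝ) :=
    (ContinuousLinearMap.mul ℝ ℝ).holderL volume 2 2 1 (e 0).toLp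
  have hM : ∀ h : Lp ℝ 2 (volume : Measure ℝ), (M h : ℝ → ℝ) =ᵐ[volume]
      fun x => Real.exp (-(1 / (4 * c)) * x ^ 2) * h x := by
    intro h
    filter_upwards [(ContinuousLinearMap.mul ℝ ℝ).coeFn_holder (r := 1) (e 0).toLp h,
      (e 0).coeFn_toLp] with x hx hx'
    refine hx.trans ?_
    rw [hx']
    simp
  -- The range contains every continuous compactly supported `g`: dividing `g` by the Gaussian keeps
  -- it in `L²`.
  have hrange : DenseRange M := by
    intro F
    rw [Metric.mem_closure_iff]
    intro ε hε
    obtain ⟨g, hgs, hgn, hgc, hgm⟩ := (Lp.memLp F).exists_hasCompactSupport_eLpNorm_sub_le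
      ENNReal.one_ne_top (ε := ENNReal.ofReal (ε / 2)) (by simpa using hε)
    have hq : MemLp (fun x => Real.exp (1 / (4 * c) * x ^ 2) * g x) 2 :=
      Continuous.memLp_of_hasCompactSupport (by fun_prop) hgs.mul_left
    refine ⟨M hq.toLp, ⟨_, rfl⟩, ?_⟩
    have hMq : M hq.toLp = hgm.toLp := by
      refine Lp.ext ?_
      filter_upwards [hM hq.toLp, hq.coeFn_toLp, hgm.coeFn_toLp] with x h1 h2 h3
      rw [h1, h2, h3, ← mul_assoc, ← Real.exp_add]
      simp
    rw [hMq, ← Lp.toLp_coeFn F (Lp.memLp F), Lp.dist_def]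
    refine lt_of_le_of_lt (ENNReal.toReal_le_of_le_ofReal (by positivity) ?_) (half_lt_self hε)
    rw [eLpNorm_congr_ae ((Lp.memLp F).coeFn_toLp.sub hgm.coeFn_toLp)]
    exact hgn
  refine (hrange.dense_image M.continuous (span_exp_mul_gaussian_dense hb)).mono ?_
  rw [← ContinuousLinearMap.coe_coe, ← Submodule.map_coe, SetLike.coe_subset_coe,
    Submodule.map_span_le]
  rintro _ ⟨a, rfl⟩
  -- Completing the square, `-x² / (2c) + a x = a² c / 2 - (x - a c)² / (2c)`, gives the shift `a *
  -- c` and the scalar below.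
  have hmem := Submodule.subset_span (R := ℝ) (s := {g : Lp ℝ 1 (volume : Measure ℝ) | ∃ a : ℝ,
    (g : ℝ → ℝ) =ᵐ[volume] fun t => ((Real.exp (-(t - a) ^ 2 / (2 * c)) : ℝ) : ℝ)})
    ⟨a * c, (memLp_translate_gaussian hc (a * c)).coeFn_toLp⟩
  convert! Submodule.smul_mem _ (Real.exp (a ^ 2 * c / 2)) hmem using 1
  refine Lp.ext ?_
  filter_upwards [hM (e a).toLp, (e a).coeFn_toLp, Lp.coeFn_smul (Real.exp (a ^ 2 * c / 2))
    (memLp_translate_gaussian hc (a * c)).toLp,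
    (memLp_translate_gaussian hc (a * c)).coeFn_toLp] with x h1 h2 h3 h4
  refine h1.trans ?_
  rw [h2, h3, Pi.smul_apply, h4, smul_eq_mul, ← Real.exp_add, ← Real.exp_add]
  congr 1
  field_simp
  ring

/-- The closed `𝕜`-span contains all real-valued functions by the real case, hence also every `F =
re F + I * im F`. -/
theorem dense_translateSpan_of_real (𝕜 : Type*) [RCLike 𝕜] {f : ℝ → ℝ}
    (h : Dense (translateSpan ℝ f : Set (Lp ℝ 1 (volume : Measure ℝ)))) :
    Dense (translateSpan 𝕜 f : Set (Lp 𝕜 1 (volume : Measure ℝ))) := by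
  let I : Lp ℝ 1 (volume : Measure ℝ) →L[ℝ] Lp 𝕜 1 (volume : Measure ℝ) :=
    (RCLike.ofRealCLM (K := 𝕜)).compLpL 1 volume
  have hI : ∀ g, (I g : ℝ → 𝕜) =ᵐ[volume] fun x => ((g x : ℝ) : 𝕜) := fun g =>
    (RCLike.ofRealCLM (K := 𝕜)).coeFn_compLpL g
  have hspan : (translateSpan ℝ f).map (I : Lp ℝ 1 (volume : Measure ℝ) →ₗ[ℝ] _) ≤
      (translateSpan 𝕜 f).restrictScalars ℝ := by
    rw [translateSpan, Submodule.map_span_le]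
    rintro g ⟨a, ha⟩
    refine Submodule.subset_span ⟨a, ?_⟩
    filter_upwards [hI g, ha] with x h1 h2
    refine h1.trans ?_
    rw [h2]
    simp
  have hmem : ∀ g, I g ∈ (translateSpan 𝕜 f).topologicalClosure := fun g =>
    closure_mono (SetLike.coe_subset_coe.2 hspan)
      (image_closure_subset_closure_image I.continuous ⟨g, h g, rfl⟩)
  rw [Submodule.dense_iff_topologicalClosure_eq_top, Submodule.eq_top_iff']
  intro F
  have hdecomp : F = I ((Lp.memLp F).re.toLp) + (RCLike.I : 𝕜) • I ((Lp.memLp F).im.toLp) := by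
    refine Lp.ext ?_
    filter_upwards [Lp.coeFn_add (I ((Lp.memLp F).re.toLp))
      ((RCLike.I : 𝕜) • I ((Lp.memLp F).im.toLp)), hI ((Lp.memLp F).re.toLp),
      hI ((Lp.memLp F).im.toLp), Lp.coeFn_smul (RCLike.I : 𝕜) (I ((Lp.memLp F).im.toLp)),
      (Lp.memLp F).re.coeFn_toLp, (Lp.memLp F).im.coeFn_toLp] with x h1 h2 h3 h4 h5 h6
    rw [h1, Pi.add_apply, h2, h4, Pi.smul_apply, h3, h5, h6, smul_eq_mul, mul_comm]
    exact (RCLike.re_add_im _).symm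
  rw [hdecomp]
  exact Submodule.add_mem _ (hmem _) (Submodule.smul_mem _ _ (hmem _))

theorem mainTheorem9 (n : ℕ) (hn : 1 ≤ n) :
    (∀ t : ℝ,
      Integrable (correlationIntegrand (fun x => Real.exp (-x ^ 2 / 2)) n) (sumMeasure n t) ∧
      correlation (fun x => Real.exp (-x ^ 2 / 2)) n t =
        (1 / Real.sqrt n * (2 * Real.pi) ^ (((n : ℝ) - 1) / 2) *
          ∏ k ∈ Finset.Icc 1 n, (Nat.factorial k : ℝ)) * Real.exp (-t ^ 2 / (2 * n))) ∧
    Dense (translateSpan ℝ (fun t => Real.exp (-t ^ 2 / (2 * n))) : Set (Lp ℝ 1 (volume : Measure ℝ))) ∧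
    Dense (translateSpan ℂ (fun t => Real.exp (-t ^ 2 / (2 * n))) : Set (Lp ℂ 1 (volume : Measure ℝ))) := by
  have hn' : (0 : ℝ) < n := by exact_mod_cast hn
  have hd := dense_translateSpan_gaussian_real hn'
  exact ⟨integrable_and_correlation_gaussian hn, hd, dense_translateSpan_of_real ℂ hd⟩
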